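/- Let $K$ be a field and $S=K[x_0,\dots,x_n]$ with the standard grading and $x_0<x_1<\dots<x_n$. For terms of the same degree put $x^\alpha\prec_{lex}x^\beta$ if $\alpha_k<\beta_k$ for $k=\max\{i:\alpha_i\neq\beta_i\}$, and $x^\alpha\prec_{revlex}x^\beta$ if $\alpha_h>\beta_h$ for $h=\min\{i:\alpha_i\neq\beta_i\}$. A monomial ideal is a segment ideal with respect to a term order if, with any term, it contains all greater terms of the same degree. It is a Borel ideal if replacing a factor $x_j$ by $x_{j+1}$ in a term of the ideal always gives a term of the ideal. It is saturated if it contains every $f\in S$ such that for each $i$ some $x_i^{k_i}f$ lies in it. A nonzero saturated Borel ideal $I$ is a gen-segment ideal with respect to a term order if, for every $s$, its minimal monomial generators of degree $s$ are the greatest terms among the terms of degree $s$ that do not lie in the ideal generated by the forms of degree $s-1$ in $I$. Let $L=L(p(z))\subset S$ be the nonzero saturated segment ideal with respect to the lex order whose Hilbert polynomial $p_{S/L}$ is $p(z)$. Then $L$ is a gen-segment ideal with respect to the revlex order if and only if $\deg p(z)\le 1$ or $L$ has at most two minimal monomial generators of degree $>1$. -/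

import Mathlib

/-! The polynomial ring `S = K[x_0, …, x_n]` is `MvPolynomial (Fin (n + 1)) K`, with the convention
`x_0 < x_1 < ⋯ < x_n`. A term `x^α` is identified with its exponent vector
`α : Fin (n + 1) →₀ ℕ`; its degree is `α.degree`. -/

namespace Terms

/-- The (graded) lex order: terms of smaller degree are smaller, and for two terms of the same
degree `x^α ≺ x^β` iff `α_k < β_k`, where `k` is the largest index with `α_k ≠ β_k`. -/
def LexLT {n : ℕ} (α β : Fin (n + 1) →₀ ℕ) : Prop :=
  α.degree < β.degree ∨
    (α.degree = β.degree ∧ ∃ k : Fin (n + 1), α k < β k ∧ ∀ i, k < i → α i = β i)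

/-- The (graded) revlex order: terms of smaller degree are smaller, and for two terms of the same
degree `x^α ≺ x^β` iff `α_h > β_h`, where `h` is the smallest index with `α_h ≠ β_h`. -/
def RevLexLT {n : ℕ} (α β : Fin (n + 1) →₀ ℕ) : Prop :=
  α.degree < β.degree ∨
    (α.degree = β.degree ∧ ∃ h : Fin (n + 1), β h < α h ∧ ∀ i, i < h → α i = β i)

/-- `x^α` arises from `x^β` by an elementary move `e_{j+1}^-`, i.e. by replacing one factor
`x_{j+1}` by `x_j`. -/
def ElementaryMove {n : ℕ} (α β : Fin (n + 1) →₀ ℕ) : Prop :=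
  ∃ j : Fin n, α + Finsupp.single j.succ 1 = β + Finsupp.single j.castSucc 1

/-- The Borel partial order `x^α <_B x^β`: `x^α` is obtained from `x^β` by finitely many
elementary moves `e_j^-`. -/
def BorelLT {n : ℕ} : (Fin (n + 1) →₀ ℕ) → (Fin (n + 1) →₀ ℕ) → Prop :=
  Relation.TransGen ElementaryMove

end Terms

namespace TermIdeal

open MvPolynomial

variable {K : Type*} [Field K] {n : ℕ}

/-- The exponents of the terms lying in `I`. -/
def termSet (I : Ideal (MvPolynomial (Fin (n + 1)) K)) : Set (Fin (n + 1) →₀ ℕ) :=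
  {α | monomial α (1 : K) ∈ I}

/-- `I` is a monomial ideal: it is generated by terms. -/
def IsMonomial (I : Ideal (MvPolynomial (Fin (n + 1)) K)) : Prop :=
  ∃ A : Set (Fin (n + 1) →₀ ℕ), I = Ideal.span ((fun α => monomial α (1 : K)) '' A)

/-- `G(I)`: the minimal generators of a monomial ideal `I`, i.e. the terms of `I` no proper divisor
of which lies in `I`. -/
def minGens (I : Ideal (MvPolynomial (Fin (n + 1)) K)) : Set (Fin (n + 1) →₀ ℕ) :=
  {α | α ∈ termSet I ∧ ∀ β ∈ termSet I, β ≤ α → β = α}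

/-- `I` is saturated: `I = {f | for all i there is k with x_i ^ k * f ∈ I}`. -/
def IsSaturated (I : Ideal (MvPolynomial (Fin (n + 1)) K)) : Prop :=
  ∀ f : MvPolynomial (Fin (n + 1)) K, (∀ i, ∃ k : ℕ, X i ^ k * f ∈ I) → f ∈ I

/-- The Hilbert function of `S/I`: the dimension over `K` of the image of the degree `t` forms. -/
noncomputable def hilbertFunction (I : Ideal (MvPolynomial (Fin (n + 1)) K)) (t : ℕ) : ℕ :=
  Module.finrank K
    ((homogeneousSubmodule (Fin (n + 1)) K t).map (Ideal.Quotient.mkₐ K I).toLinearMap)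

/-- `p` is the Hilbert polynomial of `S/I`. -/
def HasHilbertPolynomial (I : Ideal (MvPolynomial (Fin (n + 1)) K)) (p : Polynomial ℚ) : Prop :=
  ∃ N : ℕ, ∀ t : ℕ, N ≤ t → (hilbertFunction I t : ℚ) = p.eval (t : ℚ)

/-- `I` is a Borel (strongly stable) ideal. -/
def IsBorel (I : Ideal (MvPolynomial (Fin (n + 1)) K)) : Prop :=
  IsMonomial I ∧ ∀ α ∈ termSet I, ∀ β, Terms.BorelLT α β → β ∈ termSet I

/-- `I` is a segment ideal with respect to the term order `lt`: it is a monomial ideal, and with a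
term it contains all greater terms of the same degree. -/
def IsSegmentIdeal (lt : (Fin (n + 1) →₀ ℕ) → (Fin (n + 1) →₀ ℕ) → Prop)
    (I : Ideal (MvPolynomial (Fin (n + 1)) K)) : Prop :=
  IsMonomial I ∧
    ∀ α ∈ termSet I, ∀ β : Fin (n + 1) →₀ ℕ, β.degree = α.degree → lt α β → β ∈ termSet I

/-- `⟨I_{s-1}⟩`: the ideal generated by the forms of degree `s - 1` in `I` (it is `0` for
`s = 0`). -/
noncomputable def spanPred (I : Ideal (MvPolynomial (Fin (n + 1)) K)) (s : ℕ) :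
    Ideal (MvPolynomial (Fin (n + 1)) K) :=
  Ideal.span {f | f ∈ I ∧ ∃ t : ℕ, t + 1 = s ∧ f.IsHomogeneous t}

/-- `I` is a gen-segment ideal with respect to the term order `lt`: it is a non-null saturated Borel
ideal such that, for every `s`, the minimal generators of degree `s` are the greatest terms among
the terms of degree `s` outside `⟨I_{s-1}⟩`. -/
structure IsGenSegmentIdeal (lt : (Fin (n + 1) →₀ ℕ) → (Fin (n + 1) →₀ ℕ) → Prop)
    (I : Ideal (MvPolynomial (Fin (n + 1)) K)) : Prop where
  ne_bot : I ≠ ⊥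
  saturated : IsSaturated I
  borel : IsBorel I
  not_mem_spanPred : ∀ s : ℕ, ∀ α ∈ minGens I, α.degree = s → α ∉ termSet (spanPred I s)
  greatest : ∀ s : ℕ, ∀ α ∈ minGens I, α.degree = s →
    ∀ β : Fin (n + 1) →₀ ℕ, β.degree = s → β ∉ termSet (spanPred I s) → lt α β → β ∈ minGens I

end TermIdeal

/-! One term controls everything. Saturation lets powers of `x_0` be cancelled, so the terms of `L`
are exactly those from a least one, `x^γ`, upwards in the ungraded lex order, and `γ_0 = 0`
(`exists_least`). For `γ ≠ 0` let `x_{l+1}` be the largest variable in `x^γ`; the decisive condition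
is (*): `x^γ` involves no variable below `x_l`.

Under (*) a minimal generator can only be some `x_i` with `i > l+1`, the power
`x_{l+1}^{γ_{l+1}+1}`, or `x^γ`. A revlex-greater term of the same degree outside `L` would have to
divide it, which is impossible.

In a revlex gen-segment ideal no generator involves a variable below `x_l`: the power of `x_l` of
the same degree is revlex-greater but lies outside `L`. This leaves at most two generators of degree
`> 1`.

Each alternative on the right implies (*). If `γ_j ≠ 0` with `j < l`, there are three generators of
degree `> 1`; moreover all power products of `x_0, x_j, x_l` lie outside `L`, so the Hilbert
function grows at least quadratically. -/

namespace Terms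

/-! ### The ungraded lex order -/

variable {n : ℕ}

/-- The ungraded lex order on exponent vectors: at the largest index where they differ, `α` has the
smaller entry. -/
def PureLexLT (α β : Fin (n + 1) →₀ ℕ) : Prop :=
  ∃ k : Fin (n + 1), α k < β k ∧ ∀ i, k < i → α i = β i

theorem pureLexLT_wellFounded : WellFounded (PureLexLT (n := n)) := by
  -- `Pi.Lex` decides at the first index; reversing the order of the indices makes this the largest
  -- one.
  have h : WellFounded (Pi.Lex (· > ·) (fun {_ : Fin (n + 1)} => ((· < ·) : ℕ → ℕ → Prop))) :=
    Pi.Lex.wellFounded _ fun _ => wellFounded_lt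
  refine Subrelation.wf ?_ (InvImage.wf (fun α : Fin (n + 1) →₀ ℕ => (α : Fin (n + 1) → ℕ)) h)
  rintro α β ⟨k, hk, hi⟩
  exact ⟨k, fun j hj => hi j hj, hk⟩

theorem PureLexLT.asymm {α β : Fin (n + 1) →₀ ℕ} (h : PureLexLT α β) : ¬ PureLexLT β α :=
  pureLexLT_wellFounded.asymm.asymm _ _ h

theorem PureLexLT.irrefl (α : Fin (n + 1) →₀ ℕ) : ¬ PureLexLT α α :=
  fun h => h.asymm h

/-- Two distinct exponent vectors have a last index at which they differ. -/
theorem exists_last_ne {α β : Fin (n + 1) →₀ ℕ} (h : α ≠ β) :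
    ∃ k, α k ≠ β k ∧ ∀ i, k < i → α i = β i := by
  have hne : (Finset.univ.filter fun i => α i ≠ β i).Nonempty := by
    obtain ⟨i, hi⟩ := Finsupp.ne_iff.1 h
    exact ⟨i, by simpa using hi⟩
  obtain ⟨k, hk, hmax⟩ := Finset.exists_max_image _ id hne
  refine ⟨k, by simpa using hk, fun i hi => ?_⟩
  by_contra hne
  exact absurd (hmax i (by simpa using hne)) (not_le.2 hi)

theorem pureLexLT_trichotomous (α β : Fin (n + 1) →₀ ℕ) :
    PureLexLT α β ∨ α = β ∨ PureLexLT β α := by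
  by_cases h : α = β
  · exact Or.inr (Or.inl h)
  obtain ⟨k, hk, hi⟩ := exists_last_ne h
  rcases lt_or_gt_of_ne hk with h | h
  · exact Or.inl ⟨k, h, hi⟩
  · exact Or.inr (Or.inr ⟨k, h, fun i hki => (hi i hki).symm⟩)

theorem pureLexLT_of_le_of_ne {α β : Fin (n + 1) →₀ ℕ} (h : α ≤ β) (hne : α ≠ β) :
    PureLexLT α β := by
  obtain ⟨k, hk, hi⟩ := exists_last_ne hne
  exact ⟨k, lt_of_le_of_ne (h k) hk, hi⟩

end Terms

/-! ### Terms and least term of a saturated lex segment -/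

namespace TermIdeal

open MvPolynomial Terms

variable {K : Type*} [Field K] {n : ℕ} {I : Ideal (MvPolynomial (Fin (n + 1)) K)}

theorem termSet_upward {α β : Fin (n + 1) →₀ ℕ} (hα : α ∈ termSet I) (h : α ≤ β) :
    β ∈ termSet I := by
  have : monomial β (1 : K) = monomial (β - α) 1 * monomial α 1 := by
    rw [monomial_mul, one_mul, tsub_add_cancel_of_le h]
  change monomial β (1 : K) ∈ I
  rw [this]
  exact I.mul_mem_left _ hα

theorem IsMonomial.mem_termSet_of_mem_support (hI : IsMonomial I)
    {f : MvPolynomial (Fin (n + 1)) K} (hf : f ∈ I) {δ : Fin (n + 1) →₀ ℕ} (hδ : δ ∈ f.support) :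
    δ ∈ termSet I := by
  obtain ⟨A, rfl⟩ := hI
  obtain ⟨a, ha, hle⟩ := mem_ideal_span_monomial_image.1 hf δ hδ
  exact termSet_upward (Ideal.subset_span ⟨a, ha, rfl⟩) hle

theorem IsMonomial.termSet_nonempty (hI : IsMonomial I) (hne : I ≠ ⊥) : (termSet I).Nonempty := by
  obtain ⟨f, hf, hf0⟩ := Submodule.exists_mem_ne_zero_of_ne_bot hne
  obtain ⟨δ, hδ⟩ := Finset.nonempty_iff_ne_empty.2 (mt support_eq_empty.1 hf0)
  exact ⟨δ, hI.mem_termSet_of_mem_support hf hδ⟩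

/-- Every term of a form in a monomial ideal lies in the ideal, so `⟨I_{s-1}⟩` is generated by
terms. -/
theorem IsMonomial.mem_termSet_spanPred_iff (hI : IsMonomial I) {s : ℕ}
    {β : Fin (n + 1) →₀ ℕ} :
    β ∈ termSet (spanPred I s) ↔ ∃ δ ∈ termSet I, δ ≤ β ∧ δ.degree + 1 = s := by
  classical
  constructor
  · intro hβ
    have hle : spanPred I s ≤ Ideal.span ((fun α => monomial α (1 : K)) ''
        {δ | δ ∈ termSet I ∧ δ.degree + 1 = s}) := by
      refine Ideal.span_le.2 ?_
      rintro f ⟨hf, t, ht, hhom⟩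
      refine mem_ideal_span_monomial_image.2 fun δ hδ =>
        ⟨δ, ⟨hI.mem_termSet_of_mem_support hf hδ, ?_⟩, le_rfl⟩
      have hw := hhom (mem_support_iff.1 hδ)
      rw [show Finsupp.weight 1 δ = δ.degree by rw [Finsupp.degree_eq_weight_one]; rfl] at hw
      rw [hw, ht]
    obtain ⟨δ, ⟨h1, h2⟩, h3⟩ := mem_ideal_span_monomial_image.1 (hle hβ) β
      (by simp [mem_support_iff])
    exact ⟨δ, h1, h3, h2⟩
  · rintro ⟨δ, hδ, hle, hs⟩
    refine termSet_upward (I := spanPred I s) (α := δ) (Ideal.subset_span ?_) hle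
    exact ⟨hδ, δ.degree, hs, isHomogeneous_monomial _ rfl⟩

/-- A term of degree `s` is a minimal generator iff it lies in `I` but not in `⟨I_{s-1}⟩`. -/
theorem IsMonomial.mem_minGens_iff (hI : IsMonomial I) {β : Fin (n + 1) →₀ ℕ} :
    β ∈ minGens I ↔ β ∈ termSet I ∧ β ∉ termSet (spanPred I β.degree) := by
  rw [hI.mem_termSet_spanPred_iff]
  constructor
  · rintro ⟨hβ, hmin⟩
    refine ⟨hβ, ?_⟩
    rintro ⟨δ, hδ, hle, hs⟩
    rw [hmin δ hδ hle] at hs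
    omega
  · rintro ⟨hβ, hnot⟩
    refine ⟨hβ, fun δ hδ hle => ?_⟩
    by_contra hne
    obtain ⟨i, hi⟩ := Finsupp.ne_iff.1 hne
    have hi' : δ i < β i := lt_of_le_of_ne (hle i) hi
    have hs : Finsupp.single i 1 ≤ β := by
      rw [Finsupp.single_le_iff]; omega
    refine hnot ⟨β - Finsupp.single i 1, termSet_upward hδ fun j => ?_, tsub_le_self, ?_⟩
    · by_cases hj : j = i
      · subst hj; simp; omega
      · have := hle j
        simpa [Finsupp.single_apply, Ne.symm hj] using this
    · conv_rhs => rw [← tsub_add_cancel_of_le hs, map_add, Finsupp.degree_single]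

/-- Undoing an elementary move keeps the degree and raises the term in lex. -/
theorem IsSegmentIdeal.isBorel (hI : IsSegmentIdeal LexLT I) : IsBorel I := by
  refine ⟨hI.1, fun α hα β hlt => ?_⟩
  have step : ∀ {α β : Fin (n + 1) →₀ ℕ}, ElementaryMove α β → α ∈ termSet I →
      β ∈ termSet I := by
    rintro α β ⟨j, hj⟩ hα
    have hdeg : β.degree = α.degree := by
      have := congrArg Finsupp.degree hj
      simp only [map_add, Finsupp.degree_single] at this
      omega
    refine hI.2 α hα β hdeg (Or.inr ⟨hdeg.symm, j.succ, ?_, fun i hi => ?_⟩)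
    · have := DFunLike.congr_fun hj j.succ
      simp [Fin.ext_iff] at this
      omega
    · have := DFunLike.congr_fun hj i
      have h1 : j.succ ≠ i := hi.ne
      have h2 : j.castSucc ≠ i := (j.castSucc_lt_succ.trans hi).ne
      simpa [Finsupp.single_apply, h1, h2] using this
  induction hlt with
  | single h => exact step h hα
  | tail _ h ih => exact step h ih

/-- In a saturated lex-segment ideal, a power of the smallest variable can be cancelled. -/
theorem IsSegmentIdeal.mem_of_add_single_zero (hI : IsSegmentIdeal LexLT I) (hsat : IsSaturated I)
    {α : Fin (n + 1) →₀ ℕ} {k : ℕ} (h : α + Finsupp.single 0 k ∈ termSet I) : α ∈ termSet I := by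
  -- Trading `x_0^k` for `x_i^k` does not lower the term in lex, so `x_i^k x^α` lies in `I` for
  -- every `i`.
  refine hsat _ fun i => ⟨k, ?_⟩
  rw [X_pow_eq_monomial, monomial_mul, one_mul, add_comm (Finsupp.single i k)]
  change α + Finsupp.single i k ∈ termSet I
  by_cases hi : i = 0
  · rwa [hi]
  rcases Nat.eq_zero_or_pos k with rfl | hk
  · simpa using h
  refine hI.2 _ h _ (by simp) (Or.inr ⟨by simp, i, ?_, fun l hl => ?_⟩)
  · simp [Ne.symm hi, hk]
  · have h0 : (0 : Fin (n + 1)) ≠ l := ((Fin.zero_le i).trans_lt hl).ne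
    simp [hl.ne, h0]

/-- A saturated lex-segment ideal is closed under passing to terms that are greater in the ungraded
lex order. -/
theorem IsSegmentIdeal.mem_of_pureLexLT (hI : IsSegmentIdeal LexLT I) (hsat : IsSaturated I)
    {α β : Fin (n + 1) →₀ ℕ} (hα : α ∈ termSet I) (h : PureLexLT α β) : β ∈ termSet I := by
  obtain ⟨k, hk, hi⟩ := h
  by_cases hk0 : k = 0
  · refine termSet_upward hα fun i => ?_
    by_cases hik : i = 0
    · rw [hik, ← hk0]; exact hk.le
    · exact (hi i (hk0 ▸ Fin.pos_of_ne_zero hik)).le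
  -- Padding `x^α` with `x_0^{deg β}` and `x^β` with `x_0^{deg α}` equalizes the degrees and leaves
  -- the comparison at `k ≠ 0` unchanged.
  refine hI.mem_of_add_single_zero hsat (k := α.degree)
    (hI.2 (α + Finsupp.single 0 β.degree) (termSet_upward hα le_self_add) _ ?_ (Or.inr ?_))
  · simp [add_comm]
  · refine ⟨by simp [add_comm], k, ?_, fun i hki => ?_⟩
    · simpa [Finsupp.single_apply, Ne.symm hk0] using hk
    · have h0 : (0 : Fin (n + 1)) ≠ i := ((Fin.zero_le k).trans_lt hki).ne
      simpa [Finsupp.single_apply, h0] using hi i hki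

/-- The terms of a nonzero saturated lex-segment ideal are those from some term, prime to the
smallest variable, on upwards in the ungraded lex order. -/
theorem IsSegmentIdeal.exists_least (hI : IsSegmentIdeal LexLT I) (hsat : IsSaturated I)
    (hne : I ≠ ⊥) :
    ∃ γ : Fin (n + 1) →₀ ℕ, γ 0 = 0 ∧ ∀ β, β ∈ termSet I ↔ β = γ ∨ PureLexLT γ β := by
  obtain ⟨γ, hγ, hmin⟩ := pureLexLT_wellFounded.has_min _ (hI.1.termSet_nonempty hne)
  refine ⟨γ, ?_, fun β => ⟨fun hβ => ?_, ?_⟩⟩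
  · by_contra h0
    have hs : Finsupp.single 0 (γ 0) ≤ γ := by rw [Finsupp.single_le_iff]
    have heq := tsub_add_cancel_of_le hs
    have hmem : γ - Finsupp.single 0 (γ 0) ∈ termSet I :=
      hI.mem_of_add_single_zero hsat (k := γ 0) (by rwa [heq])
    refine hmin _ hmem (pureLexLT_of_le_of_ne tsub_le_self fun h => ?_)
    have := DFunLike.congr_fun h 0
    simp at this
    exact h0 this.symm
  · rcases pureLexLT_trichotomous β γ with h | h | h
    · exact absurd h (hmin β hβ)
    · exact Or.inl h
    · exact Or.inr h
  · rintro (rfl | h)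
    · exact hγ
    · exact hI.mem_of_pureLexLT hsat hγ h

end TermIdeal

/-! ### The least term and the revlex gen-segment property -/

namespace TermIdeal

open MvPolynomial Terms

variable {K : Type*} [Field K] {n : ℕ} {I : Ideal (MvPolynomial (Fin (n + 1)) K)}

theorem not_mem_iff_of_least {γ : Fin (n + 1) →₀ ℕ}
    (hT : ∀ β, β ∈ termSet I ↔ β = γ ∨ PureLexLT γ β) (β : Fin (n + 1) →₀ ℕ) :
    β ∉ termSet I ↔ PureLexLT β γ := by
  rw [hT]
  constructor
  · intro h
    rcases pureLexLT_trichotomous β γ with h' | h' | h'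
    · exact h'
    · exact absurd (Or.inl h') h
    · exact absurd (Or.inr h') h
  · rintro h (rfl | h')
    · exact h.irrefl _
    · exact h.asymm h'

/-- A nonzero saturated lex-segment ideal is a gen-segment ideal with respect to revlex if every term
outside it that beats a minimal generator at the first index where they differ divides that
generator. -/
theorem IsSegmentIdeal.isGenSegmentIdeal_of_forall (hI : IsSegmentIdeal LexLT I)
    (hsat : IsSaturated I) (hne : I ≠ ⊥)
    (h : ∀ α ∈ minGens I, ∀ β : Fin (n + 1) →₀ ℕ, β ∉ termSet I → ∀ k, β k < α k →
      (∀ i, i < k → α i = β i) → β ≤ α) :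
    IsGenSegmentIdeal RevLexLT I where
  ne_bot := hne
  saturated := hsat
  borel := hI.isBorel
  not_mem_spanPred := by
    rintro s α hα rfl
    exact (hI.1.mem_minGens_iff.1 hα).2
  greatest := by
    rintro s α hα hs β hβ hspan hlt
    subst hβ
    refine hI.1.mem_minGens_iff.2 ⟨?_, hspan⟩
    by_contra hmem
    rcases hlt with hlt | ⟨-, k, hk, hi⟩
    · omega
    have hle := h α hα β hmem k hk hi
    have : β.degree < α.degree := by
      rw [Finsupp.degree_eq_sum, Finsupp.degree_eq_sum]
      exact Finset.sum_lt_sum (fun i _ => hle i) ⟨k, Finset.mem_univ _, hk⟩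
    omega

/-- The last index where `β` and `γ` differ is at most `l+1`, because `β` cannot be smaller where
`γ` vanishes. -/
theorem not_mem_bounds {γ β : Fin (n + 1) →₀ ℕ} {l : Fin n}
    (hγ : ∀ i, l.succ < i → γ i = 0) (h : PureLexLT β γ) :
    (∀ i, l.succ < i → β i = 0) ∧ β l.succ ≤ γ l.succ ∧
      (β l.succ = γ l.succ → β l.castSucc ≤ γ l.castSucc) := by
  obtain ⟨k, hk, hi⟩ := h
  have hkm : k ≤ l.succ := by
    by_contra hc
    have := hγ k (not_le.1 hc)
    omega
  refine ⟨fun i hli => (hi i (hkm.trans_lt hli)).trans (hγ i hli), ?_, fun heq => ?_⟩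
  · rcases hkm.eq_or_lt with rfl | h
    · exact hk.le
    · exact (hi _ h).le
  · rcases hkm.eq_or_lt with rfl | h
    · omega
    · rcases (Fin.le_castSucc_iff.2 h).eq_or_lt with rfl | h
      · exact hk.le
      · exact (hi _ h).le

theorem isGenSegmentIdeal_of_least_zero (hI : IsSegmentIdeal LexLT I)
    (hsat : IsSaturated I) (hne : I ≠ ⊥)
    (hT : ∀ β, β ∈ termSet I ↔ β = 0 ∨ PureLexLT 0 β) : IsGenSegmentIdeal RevLexLT I := by
  refine hI.isGenSegmentIdeal_of_forall hsat hne fun α _ β hβ => ?_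
  obtain ⟨k, hk, -⟩ := (not_mem_iff_of_least hT β).1 hβ
  simp at hk

/-- If the least term involves only two consecutive variables, then the ideal is a gen-segment ideal
with respect to revlex. -/
theorem isGenSegmentIdeal_of_least_two_variables (hI : IsSegmentIdeal LexLT I)
    (hsat : IsSaturated I) (hne : I ≠ ⊥) {γ : Fin (n + 1) →₀ ℕ}
    (hT : ∀ β, β ∈ termSet I ↔ β = γ ∨ PureLexLT γ β) {l : Fin n}
    (hγ : ∀ i, l.succ < i → γ i = 0) (hγ' : ∀ i, i < l.castSucc → γ i = 0) :
    IsGenSegmentIdeal RevLexLT I := by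
  refine hI.isGenSegmentIdeal_of_forall hsat hne fun α hα β hβ h hh heq => ?_
  obtain ⟨hb1, hb2, hb3⟩ := not_mem_bounds hγ ((not_mem_iff_of_least hT β).1 hβ)
  -- The generator is a single variable `x_i` with `i > l+1`.
  by_cases h1 : ∃ i, l.succ < i ∧ α i ≠ 0
  · obtain ⟨i, hli, hi⟩ := h1
    have hα1 : Finsupp.single i 1 = α := by
      refine hα.2 _ ((hT _).2 (Or.inr ⟨i, ?_, fun j hj => ?_⟩)) ?_
      · rw [hγ i hli]; simp
      · rw [hγ j (hli.trans hj), Finsupp.single_eq_of_ne hj.ne']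
      · rw [Finsupp.single_le_iff]; omega
    have hhi : h = i := by
      by_contra hc
      rw [← hα1, Finsupp.single_eq_of_ne hc] at hh
      omega
    subst hhi
    intro j
    rcases lt_trichotomy j h with hj | rfl | hj
    · exact (heq j hj).ge
    · exact hh.le
    · rw [hb1 j (hli.trans hj)]; exact Nat.zero_le _
  push Not at h1
  have hle : ∀ j, l.succ < j → β j ≤ α j := fun j hj => by rw [hb1 j hj]; exact Nat.zero_le _
  -- The generator is `x_{l+1}^{γ_{l+1}+1}`.
  by_cases h2 : γ l.succ < α l.succ
  · have hα2 : Finsupp.single l.succ (γ l.succ + 1) = α := by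
      refine hα.2 _ ((hT _).2 (Or.inr ⟨l.succ, by simp, fun j hj => ?_⟩)) ?_
      · rw [hγ j hj, Finsupp.single_eq_of_ne hj.ne']
      · rw [Finsupp.single_le_iff]; omega
    have hhi : h = l.succ := by
      by_contra hc
      rw [← hα2, Finsupp.single_eq_of_ne hc] at hh
      omega
    subst hhi
    intro j
    rcases lt_trichotomy j l.succ with hj | rfl | hj
    · exact (heq j hj).ge
    · exact hh.le
    · exact hle j hj
  -- The only remaining generator is `x^γ`: as `γ` vanishes below `l`, it divides every term of `I`
  -- still in play.
  have hα3 : γ = α := by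
    refine hα.2 γ ((hT _).2 (Or.inl rfl)) ?_
    rcases (hT α).1 hα.1 with rfl | ⟨k, hk, hki⟩
    · exact le_rfl
    have hkl : k ≤ l.castSucc := by
      rw [Fin.le_castSucc_iff]
      rcases lt_trichotomy k l.succ with hc | rfl | hc
      · exact hc
      · exact absurd hk h2
      · rw [h1 k hc] at hk; omega
    intro j
    rcases lt_trichotomy j l.castSucc with hj | rfl | hj
    · rw [hγ' j hj]; exact Nat.zero_le _
    · rcases hkl.eq_or_lt with rfl | hc
      · exact hk.le
      · exact (hki _ hc).le
    · exact (hki j (hkl.trans_lt hj)).le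
  subst hα3
  have hlh : l.castSucc ≤ h := by
    by_contra hc
    rw [hγ' h (not_le.1 hc)] at hh
    omega
  intro j
  rcases lt_trichotomy j l.castSucc with hj | rfl | hj
  · exact (heq j (hj.trans_le hlh)).ge
  · rcases hlh.eq_or_lt with rfl | hc
    · exact hh.le
    · exact (heq _ hc).ge
  · rcases (Fin.castSucc_lt_iff_succ_le.1 hj).eq_or_lt with rfl | hj
    · exact hb2
    · exact hle j hj

/-- A gen-segment ideal with respect to revlex that is a lex-segment has at most two minimal
generators of degree greater than one. -/
theorem IsGenSegmentIdeal.encard_le_two (hgen : IsGenSegmentIdeal RevLexLT I)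
    {γ : Fin (n + 1) →₀ ℕ} (hT : ∀ β, β ∈ termSet I ↔ β = γ ∨ PureLexLT γ β) {l : Fin n}
    (hγ : ∀ i, l.succ < i → γ i = 0) (hl : γ l.succ ≠ 0) :
    {α ∈ minGens I | 1 < α.degree}.encard ≤ 2 := by
  -- The competitor is `x_l^{deg α}`: lex-smaller than `x^γ`, hence outside `I`, yet revlex-greater
  -- than `x^α` if `α` involves a variable below `x_l`.
  have hsupp : ∀ α ∈ minGens I, ∀ i, i < l.castSucc → α i = 0 := by
    intro α hα i hi
    by_contra hne
    have hnot : Finsupp.single l.castSucc α.degree ∉ termSet I := by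
      refine (not_mem_iff_of_least hT _).2 ⟨l.succ, ?_, fun j hj => ?_⟩
      · rw [Finsupp.single_eq_of_ne (Fin.castSucc_lt_succ (i := l)).ne']
        exact Nat.pos_of_ne_zero hl
      · rw [hγ j hj, Finsupp.single_eq_of_ne (Fin.castSucc_lt_succ.trans hj).ne']
    have hex : ∃ k, k < l.castSucc ∧ α k ≠ 0 ∧ ∀ j, j < k → α j = 0 := by
      have hne' : (Finset.univ.filter fun j => α j ≠ 0).Nonempty := ⟨i, by simpa using hne⟩
      obtain ⟨k, hk, hmin⟩ := Finset.exists_min_image _ id hne'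
      refine ⟨k, (hmin i (by simpa using hne)).trans_lt hi, by simpa using hk, fun j hj => ?_⟩
      by_contra hc
      exact absurd (hmin j (by simpa using hc)) (not_le.2 hj)
    obtain ⟨k, hkl, hk, hkj⟩ := hex
    refine hnot (hgen.greatest _ α hα rfl _ (by simp) ?_ (Or.inr ⟨by simp, k, ?_, ?_⟩)).1
    · intro hmem
      obtain ⟨δ, hδ, hle, -⟩ := hgen.borel.1.mem_termSet_spanPred_iff.1 hmem
      exact hnot (termSet_upward hδ hle)
    · rw [Finsupp.single_eq_of_ne hkl.ne]
      exact Nat.pos_of_ne_zero hk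
    · intro j hj
      rw [hkj j hj, Finsupp.single_eq_of_ne (hj.trans hkl).ne]
  have hsub : {α ∈ minGens I | 1 < α.degree} ⊆ {Finsupp.single l.succ (γ l.succ + 1)} ∪
      {α ∈ minGens I | α l.succ = γ l.succ ∧ ∀ i, l.succ < i → α i = 0} := by
    rintro α ⟨hα, hdeg⟩
    have h1 : ∀ i, l.succ < i → α i = 0 := by
      intro i hli
      by_contra hi
      have hα1 : Finsupp.single i 1 = α := by
        refine hα.2 _ ((hT _).2 (Or.inr ⟨i, ?_, fun j hj => ?_⟩)) ?_
        · rw [hγ i hli]; simp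
        · rw [hγ j (hli.trans hj), Finsupp.single_eq_of_ne hj.ne']
        · rw [Finsupp.single_le_iff]; omega
      rw [← hα1, Finsupp.degree_single] at hdeg
      omega
    rcases lt_trichotomy (α l.succ) (γ l.succ) with h2 | h2 | h2
    · refine absurd hα.1 ((not_mem_iff_of_least hT _).2 ⟨_, h2, fun j hj => ?_⟩)
      rw [h1 j hj, hγ j hj]
    · exact Or.inr ⟨hα, h2, h1⟩
    · left
      refine (hα.2 _ ((hT _).2 (Or.inr ⟨l.succ, by simp, fun j hj => ?_⟩)) ?_).symm
      · rw [hγ j hj, Finsupp.single_eq_of_ne hj.ne']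
      · rw [Finsupp.single_le_iff]; omega
  -- By `hsupp`, such generators can differ only in the exponent of `x_l`, so one divides the other.
  have hone : {α ∈ minGens I | α l.succ = γ l.succ ∧
      ∀ i, l.succ < i → α i = 0}.encard ≤ 1 := by
    have key : ∀ α ∈ minGens I, ∀ β ∈ minGens I, α l.succ = β l.succ →
        (∀ i, l.succ < i → α i = β i) → α l.castSucc ≤ β l.castSucc → α = β := by
      intro α hα β hβ h1 h2 h3
      refine hβ.2 α hα.1 fun j => ?_
      rcases lt_trichotomy j l.castSucc with hj | rfl | hj
      · rw [hsupp α hα j hj]; exact Nat.zero_le _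
      · exact h3
      · rcases (Fin.castSucc_lt_iff_succ_le.1 hj).eq_or_lt with rfl | hj
        · exact h1.le
        · exact (h2 j hj).le
    rw [Set.encard_le_one_iff]
    rintro α β ⟨hα, ha, ha'⟩ ⟨hβ, hb, hb'⟩
    rcases le_total (α l.castSucc) (β l.castSucc) with h | h
    · exact key α hα β hβ (ha.trans hb.symm) (fun i hi => (ha' i hi).trans (hb' i hi).symm) h
    · exact (key β hβ α hα (hb.trans ha.symm)
        (fun i hi => (hb' i hi).trans (ha' i hi).symm) h).symm
  calc _ ≤ _ := Set.encard_le_encard hsub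
    _ ≤ _ := Set.encard_union_le _ _
    _ ≤ 1 + 1 := add_le_add (Set.encard_singleton _).le hone
    _ = 2 := one_add_one_eq_two

/-- If there are at most two minimal generators of degree greater than one, then the least term
involves only two consecutive variables. -/
theorem least_eq_zero_of_encard_le_two {γ : Fin (n + 1) →₀ ℕ}
    (hT : ∀ β, β ∈ termSet I ↔ β = γ ∨ PureLexLT γ β) {l : Fin n}
    (hγ : ∀ i, l.succ < i → γ i = 0) (hl : γ l.succ ≠ 0)
    (hcard : {α ∈ minGens I | 1 < α.degree}.encard ≤ 2) {j : Fin (n + 1)}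
    (hj : j < l.castSucc) : γ j = 0 := by
  by_contra hne
  have hlm : l.castSucc ≠ l.succ := (Fin.castSucc_lt_succ (i := l)).ne
  have hjm : j < l.succ := hj.trans Fin.castSucc_lt_succ
  -- Together with `γ` these are three distinct generators. Both are lex-greater than `γ`, and `γ`
  -- divides neither because `γ j ≠ 0`.
  set s₁ : Fin (n + 1) →₀ ℕ := Finsupp.single l.succ (γ l.succ + 1) with hs₁
  set s₂ : Fin (n + 1) →₀ ℕ :=
    Finsupp.single l.succ (γ l.succ) + Finsupp.single l.castSucc (γ l.castSucc + 1) with hs₂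
  have e₁ : ∀ i, i ≠ l.succ → s₁ i = 0 := fun i hi => Finsupp.single_eq_of_ne hi
  have e₁' : s₁ l.succ = γ l.succ + 1 := by simp [hs₁]
  have e₂ : ∀ i, i ≠ l.succ → i ≠ l.castSucc → s₂ i = 0 := fun i hi hi' => by
    simp [hs₂, Finsupp.single_eq_of_ne hi, Finsupp.single_eq_of_ne hi']
  have e₂' : s₂ l.succ = γ l.succ := by simp [hs₂, Finsupp.single_eq_of_ne hlm.symm]
  have e₂'' : s₂ l.castSucc = γ l.castSucc + 1 := by simp [hs₂, Finsupp.single_eq_of_ne hlm]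
  have m₁ : s₁ ∈ minGens I := by
    refine ⟨(hT _).2 (Or.inr ⟨l.succ, by omega, fun i hi => ?_⟩), fun β hβ hle => ?_⟩
    · rw [hγ i hi, e₁ i hi.ne']
    rcases (hT β).1 hβ with rfl | ⟨k, hk, -⟩
    · have := hle j
      rw [e₁ j hjm.ne] at this
      omega
    have hkm : k = l.succ := by
      by_contra hc
      have := hle k
      rw [e₁ k hc] at this
      omega
    subst hkm
    refine le_antisymm hle fun i => ?_
    by_cases hi : i = l.succ
    · subst hi; omega
    · rw [e₁ i hi]; exact Nat.zero_le _
  have m₂ : s₂ ∈ minGens I := by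
    refine ⟨(hT _).2 (Or.inr ⟨l.castSucc, by omega, fun i hi => ?_⟩), fun β hβ hle => ?_⟩
    · rcases (Fin.castSucc_lt_iff_succ_le.1 hi).eq_or_lt with rfl | hi'
      · exact e₂'.symm
      · rw [hγ i hi', e₂ i hi'.ne' hi.ne']
    rcases (hT β).1 hβ with rfl | ⟨k, hk, hki⟩
    · have := hle j
      rw [e₂ j hjm.ne hj.ne] at this
      omega
    have hkl : k = l.castSucc := by
      by_contra hc
      have := hle k
      by_cases hkm : k = l.succ
      · subst hkm; omega
      · rw [e₂ k hkm hc] at this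
        omega
    subst hkl
    refine le_antisymm hle fun i => ?_
    by_cases hi : i = l.succ
    · subst hi; rw [e₂', hki _ Fin.castSucc_lt_succ]
    by_cases hi' : i = l.castSucc
    · subst hi'; omega
    · rw [e₂ i hi hi']; exact Nat.zero_le _
  have m₃ : γ ∈ minGens I := by
    refine ⟨(hT _).2 (Or.inl rfl), fun β hβ hle => ?_⟩
    rcases (hT β).1 hβ with h | ⟨k, hk, -⟩
    · exact h
    · exact absurd (hle k) (not_le.2 hk)
  have d₃ : 1 < γ.degree := by
    have hle : Finsupp.single l.succ 1 + Finsupp.single j 1 ≤ γ := by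
      intro i
      by_cases hi : i = l.succ
      · subst hi
        simp [Finsupp.single_eq_of_ne hjm.ne']
        omega
      by_cases hi' : i = j
      · subst hi'
        simp [Finsupp.single_eq_of_ne hi]
        omega
      · simp [Finsupp.single_eq_of_ne hi, Finsupp.single_eq_of_ne hi']
    have := Finsupp.degree_mono hle
    simp only [map_add, Finsupp.degree_single] at this
    omega
  have h12 : s₁ ≠ s₂ := fun h => by
    have := DFunLike.congr_fun h l.succ
    omega
  have h13 : s₁ ≠ γ := fun h => hne (by rw [← h, e₁ j hjm.ne])
  have h23 : s₂ ≠ γ := fun h => hne (by rw [← h, e₂ j hjm.ne hj.ne])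
  have hsub : ({s₁, s₂, γ} : Set _) ⊆ {α ∈ minGens I | 1 < α.degree} := by
    rintro α (rfl | rfl | rfl)
    · exact ⟨m₁, by rw [hs₁, Finsupp.degree_single]; omega⟩
    · exact ⟨m₂, by rw [hs₂, map_add, Finsupp.degree_single, Finsupp.degree_single]; omega⟩
    · exact ⟨m₃, d₃⟩
  have h3 : ({s₁, s₂, γ} : Set (Fin (n + 1) →₀ ℕ)).encard = 3 :=
    Set.encard_eq_three.2 ⟨s₁, s₂, γ, h12, h13, h23, rfl⟩
  have := (Set.encard_le_encard hsub).trans hcard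
  rw [h3] at this
  exact absurd this (by decide)

/-! ### Growth of the Hilbert function -/

/-- Terms outside a monomial ideal are linearly independent modulo it. -/
theorem IsMonomial.card_le_hilbertFunction (hI : IsMonomial I) {t : ℕ}
    (s : Finset (Fin (n + 1) →₀ ℕ)) (hs : ∀ δ ∈ s, δ.degree = t ∧ δ ∉ termSet I) :
    s.card ≤ hilbertFunction I t := by
  have hli : LinearIndependent K
      fun δ : s => Ideal.Quotient.mkₐ K I (monomial (δ : Fin (n + 1) →₀ ℕ) (1 : K)) := by
    rw [Fintype.linearIndependent_iff]
    intro g hg δ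
    by_contra hne
    have hmem : ∑ δ : s, g δ • monomial (δ : Fin (n + 1) →₀ ℕ) (1 : K) ∈ I := by
      rw [← Ideal.Quotient.eq_zero_iff_mem, ← hg]
      change Ideal.Quotient.mkₐ K I _ = _
      simp only [map_sum, map_smul]
    refine (hs δ δ.2).2 (hI.mem_termSet_of_mem_support hmem ?_)
    rw [mem_support_iff, coeff_sum, Finset.sum_eq_single δ]
    · simpa using hne
    · intro ε _ hε
      simp [coeff_monomial, hε]
    · simp
  -- Without finite dimension `finrank` would not be monotone.
  have : Module.Finite K (homogeneousSubmodule (Fin (n + 1)) K t) :=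
    Module.Finite.iff_fg.2 (homogeneousSubmodule_fg _ _ _)
  rw [← Fintype.card_coe s, ← finrank_span_eq_card hli]
  refine Submodule.finrank_mono (Submodule.span_le.2 ?_)
  rintro _ ⟨δ, rfl⟩
  exact ⟨_, isHomogeneous_monomial _ (hs δ δ.2).1, rfl⟩

/-- If no power product of three of the variables lies in a monomial ideal, then its Hilbert
polynomial has degree at least two. -/
theorem IsMonomial.one_lt_degree (hI : IsMonomial I) {p : Polynomial ℚ}
    (hp : HasHilbertPolynomial I p) {x y z : Fin (n + 1)} (hxy : x ≠ y) (hxz : x ≠ z)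
    (hyz : y ≠ z)
    (h : ∀ a b c : ℕ, Finsupp.single x a + Finsupp.single y b + Finsupp.single z c ∉ termSet I) :
    1 < p.degree := by
  classical
  by_contra hdeg
  obtain ⟨N, hN⟩ := hp
  obtain ⟨M, hM⟩ := exists_nat_ge (2 * |p.coeff 1| + |p.coeff 0|)
  -- If `deg p ≤ 1`, then `p(2u) ≤ M u ≤ u² < (u+1)²`. The summand `N` reaches the range where `p`
  -- is valid, and `u ≥ 1` absorbs the constant coefficient.
  set u : ℕ := N + M + 1 with hu
  have hcard : (u + 1) * (u + 1) ≤ hilbertFunction I (2 * u) := by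
    -- Exponents `a, b ≤ u` are free; in degree `2u` the truncated subtraction for the third
    -- exponent is then exact.
    let f : ℕ × ℕ → (Fin (n + 1) →₀ ℕ) := fun q =>
      Finsupp.single x q.1 + Finsupp.single y q.2 + Finsupp.single z (2 * u - q.1 - q.2)
    have hf : Function.Injective f := by
      rintro ⟨a, b⟩ ⟨a', b'⟩ hab
      have h1 := DFunLike.congr_fun hab x
      have h2 := DFunLike.congr_fun hab y
      simp [f, Finsupp.single_eq_of_ne hxy, Finsupp.single_eq_of_ne hxz] at h1
      simp [f, Finsupp.single_eq_of_ne hxy.symm, Finsupp.single_eq_of_ne hyz] at h2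
      rw [h1, h2]
    have := hI.card_le_hilbertFunction (t := 2 * u)
      ((Finset.range (u + 1) ×ˢ Finset.range (u + 1)).image f) ?_
    · rwa [Finset.card_image_of_injective _ hf, Finset.card_product, Finset.card_range] at this
    · intro δ hδ
      obtain ⟨⟨a, b⟩, hab, rfl⟩ := Finset.mem_image.1 hδ
      simp only [Finset.mem_product, Finset.mem_range] at hab
      refine ⟨?_, h _ _ _⟩
      simp only [f, map_add, Finsupp.degree_single]
      omega
  have heval := hN (2 * u) (by omega)
  rw [Polynomial.eq_X_add_C_of_degree_le_one (not_lt.1 hdeg)] at heval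
  simp only [Polynomial.eval_add, Polynomial.eval_mul, Polynomial.eval_C, Polynomial.eval_X]
    at heval
  have hcard' : ((u : ℚ) + 1) * (u + 1) ≤ hilbertFunction I (2 * u) := by exact_mod_cast hcard
  rw [heval] at hcard'
  have hu1 : (1 : ℚ) ≤ u := by exact_mod_cast (by omega : 1 ≤ u)
  have huM : (M : ℚ) ≤ u := by exact_mod_cast (by omega : M ≤ u)
  have h1 : p.coeff 1 * (2 * u) ≤ 2 * |p.coeff 1| * u := by
    nlinarith [le_abs_self (p.coeff 1)]
  have h0 : p.coeff 0 ≤ |p.coeff 0| * u := by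
    nlinarith [le_abs_self (p.coeff 0), abs_nonneg (p.coeff 0)]
  have h2 : (2 * |p.coeff 1| + |p.coeff 0|) * u ≤ u * u :=
    mul_le_mul_of_nonneg_right (hM.trans huM) (by linarith)
  push_cast at hcard'
  nlinarith

end TermIdeal

/-! ### The equivalence -/

theorem mainTheorem9 {K : Type*} [Field K] (n : ℕ) (p : Polynomial ℚ)
    (L : Ideal (MvPolynomial (Fin (n + 1)) K)) (hL_ne : L ≠ ⊥)
    (hL_sat : TermIdeal.IsSaturated L)
    (hL_seg : TermIdeal.IsSegmentIdeal Terms.LexLT L)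
    (hL_hilb : TermIdeal.HasHilbertPolynomial L p) :
    TermIdeal.IsGenSegmentIdeal Terms.RevLexLT L ↔
      (p.degree ≤ 1 ∨ {α ∈ TermIdeal.minGens L | 1 < α.degree}.encard ≤ 2) := by
  obtain ⟨γ, hγ0, hT⟩ := hL_seg.exists_least hL_sat hL_ne
  -- If `γ = 0`, then `L` is the unit ideal and `x^γ` has no largest variable.
  by_cases hγ : γ = 0
  · subst hγ
    refine iff_of_true (TermIdeal.isGenSegmentIdeal_of_least_zero hL_seg hL_sat hL_ne hT)
      (Or.inr ?_)
    have hempty : {α ∈ TermIdeal.minGens L | 1 < α.degree} = ∅ := by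
      refine Set.eq_empty_of_forall_notMem ?_
      rintro α ⟨hα, hdeg⟩
      rw [← hα.2 0 ((hT 0).2 (Or.inl rfl)) zero_le] at hdeg
      simp at hdeg
    simp [hempty]
  obtain ⟨m, hm, hmi⟩ := Terms.exists_last_ne hγ
  have hm0 : m ≠ 0 := fun h => hm (by rw [h, hγ0]; rfl)
  obtain ⟨l, rfl⟩ := Fin.exists_succ_eq.2 hm0
  refine ⟨fun hgen => Or.inr (hgen.encard_le_two hT hmi hm), fun h => ?_⟩
  refine TermIdeal.isGenSegmentIdeal_of_least_two_variables hL_seg hL_sat hL_ne hT hmi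
    fun j hj => ?_
  rcases h with hdeg | hcard
  -- Since `γ_0 = 0`, the indices `0 < j < l` are distinct. Products of these three variables omit
  -- `x_{l+1}` and everything above, so they are lex-smaller than `x^γ`.
  · by_contra hne
    have hj0 : j ≠ 0 := fun h => hne (by rw [h, hγ0])
    refine absurd hdeg (not_le.2 (hL_seg.1.one_lt_degree hL_hilb hj0.symm
      ((Fin.zero_le j).trans_lt hj).ne hj.ne fun a b c => ?_))
    have hjm : j < l.succ := hj.trans Fin.castSucc_lt_succ
    have hsum : ∀ i, l.succ ≤ i →
        (Finsupp.single 0 a + Finsupp.single j b + Finsupp.single l.castSucc c :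
          Fin (n + 1) →₀ ℕ) i = 0 := by
      intro i hi
      simp [Finsupp.single_eq_of_ne ((Fin.succ_pos l).trans_le hi).ne',
        Finsupp.single_eq_of_ne (hjm.trans_le hi).ne',
        Finsupp.single_eq_of_ne (Fin.castSucc_lt_succ.trans_le hi).ne']
    refine (TermIdeal.not_mem_iff_of_least hT _).2 ⟨l.succ, ?_, fun i hi => ?_⟩
    · rw [hsum _ le_rfl]
      exact Nat.pos_of_ne_zero hm
    · rw [hsum i hi.le, hmi i hi]; rfl
  · exact TermIdeal.least_eq_zero_of_encard_le_two hT hmi hm hcard hj
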